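/- \textbf{Setting.} Let $A\in\mathbb R^{n\times n}$, $B\in\mathbb R^{n\times l}$, $E\in\mathbb R^{n\times m}$, $z\in\mathbb R^n$ with $(A,B)$ stabilizable; let $Q_1,Q_2\in\mathbb R^{n\times n}$ and $R_2\in\mathbb R^{l\times l}$ be symmetric positive semidefinite, $R_1\in\mathbb R^{l\times l}$ symmetric positive definite, $s\in\mathbb R^n$, $v\in\mathbb R^l$, $c\in\mathbb R$. Let $(\Omega,\mathcal F,\mathbb P)$ be a probability space and $(W(k))_{k\in\mathbb N_0}$ an i.i.d. sequence in $L^2(\Omega;\mathbb R^m)$ with law $\varrho_W$ and mean $\mu_W$. Put $f(x,u,w)=Ax+Bu+Ew+z$ and, for $X\in L^2(\Omega;\mathbb R^n)$, $U\in L^2(\Omega;\mathbb R^l)$, $$\ell(X,U)=\mathbb E\big[X^TQ_1X+U^TR_1U+s^TX+v^TU+c\big]+\operatorname{Tr}\big(Q_2\operatorname{Cov}(X)\big)+\operatorname{Tr}\big(R_2\operatorname{Cov}(U)\big).$$ State and control processes $(X(\cdot),U(\cdot))$ are always square integrable, with $W(k)$ independent of $(X(k),U(k))$ and $X(k+1)=f(X(k),U(k),W(k))$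 almost surely for all $k\in\mathbb N_0$; such a pair is \emph{stationary} if the laws of $X(k)$ and of $U(k)$ do not depend on $k$. Let $\mathbb F$ be the set of measurable $\pi:\mathbb R^n\to\mathbb R^l$ with $\pi\circ X\in L^2$ for every $X\in L^2(\Omega;\mathbb R^n)$. A stationary pair is \emph{in feedback form} with $(\varrho,\pi)$, $\pi\in\mathbb F$, if $X(k)\sim\varrho$ and $U(k)=\pi\circ X(k)$ almost surely for all $k$. \textbf{Assumptions.} The equation $(I-A)x^s-Bu^s=E\mu_W+z$ has a solution $(x^s,u^s)$, and $(A,Q_1^{1/2})$ is detectable. \textbf{The reference pair.} Let $P$ be the positive semidefinite solution of $$P=A^TPA+(Q_1+Q_2)-A^TPB\,[(R_1+R_2)+B^TPB]^{-1}B^TPA,$$ and let $K=-[(R_1+R_2)+B^TPB]^{-1}B^TPA$. Let $(\tilde x,\tilde u)$ minimize $x^TQ_1x+u^TR_1u+\hat s^Tx+\hat v^Tu+\hat c$ over all $(x,u)$ with $(I-A)x-Bu=0$, where $\hat s=s+2Q_1x^s$, $\hat v=v+2R_1u^s$ and $\hat c=(x^s)^TQ_1x^s+(u^s)^TR_1u^s+s^Tx^s+v^Tu^s+c$.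 Let $(X^s_\star(\cdot),U^s_\star(\cdot))$ be a stationary pair with $U^s_\star(k)=K(X^s_\star(k)-\tilde x-x^s)+\tilde u+u^s$ almost surely for all $k$. \textbf{The stationary optimization problem.} Minimize $\ell(X,\pi\circ X)$ over all pairs $(\varrho,\pi)$ of a probability measure $\varrho$ on $\mathbb R^n$ and $\pi\in\mathbb F$ for which there are independent $X\in L^2(\Omega;\mathbb R^n)$, $X\sim\varrho$, and $W\in L^2(\Omega;\mathbb R^m)$, $W\sim\varrho_W$, with $f(X,\pi\circ X,W)\sim\varrho$. \textbf{Claim.} Let $(\bar\varrho,\bar\pi)$ be any solution of the stationary optimization problem, and let $(\bar X(\cdot),\bar U(\cdot))$ be any stationary pair in feedback form with $(\bar\varrho,\bar\pi)$. Then $$\Vert\bar X(k)-X^s_\star(k)\Vert_{L^2}\to0\quad\text{as }k\to\infty,$$ and moreover there is a constant $C$ with $\sum_{k=0}^{N-1}\mathbb E\big[\Vert\bar X(k)-X^s_\star(k)\Vert^2\big]\le C$ for all $N\in\mathbb N_0$. -/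

import Mathlib

open MeasureTheory ProbabilityTheory Filter Topology
open scoped MatrixOrder

noncomputable section

namespace StochLQ

/-- `ℝⁿ` with the Euclidean norm. -/
abbrev Vec (n : ℕ) : Type := EuclideanSpace ℝ (Fin n)

/-- The matrix-vector product `M x`. -/
def app {p q : ℕ} (M : Matrix (Fin p) (Fin q) ℝ) (x : Vec q) : Vec p :=
  Matrix.toEuclideanLin M x

/-- The quadratic form `xᵀ M x`. -/
def quad {p : ℕ} (M : Matrix (Fin p) (Fin p) ℝ) (x : Vec p) : ℝ :=
  inner ℝ x (app M x)

/-- The data of a generalized discrete-time stochastic linear-quadratic problem: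
dynamics `X⁺ = A X + B U + E W + z`, and cost coefficients. -/
structure LQData (n l m : ℕ) where
  A : Matrix (Fin n) (Fin n) ℝ
  B : Matrix (Fin n) (Fin l) ℝ
  E : Matrix (Fin n) (Fin m) ℝ
  z : Vec n
  Q₁ : Matrix (Fin n) (Fin n) ℝ
  Q₂ : Matrix (Fin n) (Fin n) ℝ
  R₁ : Matrix (Fin l) (Fin l) ℝ
  R₂ : Matrix (Fin l) (Fin l) ℝ
  s : Vec n
  v : Vec l
  c : ℝ

/-- All complex eigenvalues lie in the open unit disc. -/
def IsSchur {n : ℕ} (M : Matrix (Fin n) (Fin n) ℝ) : Prop :=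
  ∀ μ ∈ spectrum ℂ (M.map (algebraMap ℝ ℂ)), ‖μ‖ < 1

/-- `(A, B)` is stabilizable. -/
def Stabilizable {n l : ℕ} (A : Matrix (Fin n) (Fin n) ℝ) (B : Matrix (Fin n) (Fin l) ℝ) : Prop :=
  ∃ F : Matrix (Fin l) (Fin n) ℝ, IsSchur (A + B * F)

/-- `(A, C)` is detectable. -/
def Detectable {n p : ℕ} (A : Matrix (Fin n) (Fin n) ℝ) (C : Matrix (Fin p) (Fin n) ℝ) : Prop :=
  ∃ L : Matrix (Fin n) (Fin p) ℝ, IsSchur (A + L * C)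

/-- `ϱ` has finite second moment. -/
def FiniteSecondMoment {n : ℕ} (ϱ : ProbabilityMeasure (Vec n)) : Prop :=
  ∫⁻ x, ‖x‖ₑ ^ 2 ∂(ϱ : Measure (Vec n)) < ⊤

/-- The mean vector of a distribution. -/
def mean {n : ℕ} (ϱ : ProbabilityMeasure (Vec n)) : Vec n :=
  ∫ x, x ∂(ϱ : Measure (Vec n))

namespace LQData

variable {n l m : ℕ} (D : LQData n l m)

/-- The dynamics `f(x, u, w) = A x + B u + E w + z`. -/
def f (x : Vec n) (u : Vec l) (w : Vec m) : Vec n :=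
  app D.A x + app D.B u + app D.E w + D.z

/-- `(A, B)` is stabilizable, `Q₁, Q₂, R₂` are symmetric positive semidefinite and `R₁` is
symmetric positive definite. -/
structure Standing : Prop where
  stabilizable : Stabilizable D.A D.B
  posSemidef_Q₁ : D.Q₁.PosSemidef
  posSemidef_Q₂ : D.Q₂.PosSemidef
  posDef_R₁ : D.R₁.PosDef
  posSemidef_R₂ : D.R₂.PosSemidef

/-- `P` is a positive semidefinite solution of the discrete-time algebraic Riccati equation. -/
def IsRiccati (P : Matrix (Fin n) (Fin n) ℝ) : Prop :=
  P.PosSemidef ∧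
    P = D.A.transpose * P * D.A + (D.Q₁ + D.Q₂) -
      D.A.transpose * P * D.B * ((D.R₁ + D.R₂) + D.B.transpose * P * D.B)⁻¹ *
        D.B.transpose * P * D.A

/-- The gain `K = -[(R₁ + R₂) + Bᵀ P B]⁻¹ Bᵀ P A`. -/
def gain (P : Matrix (Fin n) (Fin n) ℝ) : Matrix (Fin l) (Fin n) ℝ :=
  -(((D.R₁ + D.R₂) + D.B.transpose * P * D.B)⁻¹ * D.B.transpose * P * D.A)

/-- `(x, u)` solves `(I - A) x - B u = E μ_W + z`. -/
def IsSteadyState (μW : Vec m) (x : Vec n) (u : Vec l) : Prop :=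
  app (1 - D.A) x - app D.B u = app D.E μW + D.z

/-- The deterministic stage cost in the coordinates shifted by `(xs, us)`:
`xᵀ Q₁ x + uᵀ R₁ u + ŝᵀ x + v̂ᵀ u + ĉ` with `ŝ = s + 2 Q₁ xs`, `v̂ = v + 2 R₁ us` and
`ĉ = xsᵀ Q₁ xs + usᵀ R₁ us + sᵀ xs + vᵀ us + c`. -/
def shiftedDetCost (xs : Vec n) (us : Vec l) (x : Vec n) (u : Vec l) : ℝ :=
  quad D.Q₁ x + quad D.R₁ u + inner ℝ (D.s + (2 : ℝ) • app D.Q₁ xs) x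
    + inner ℝ (D.v + (2 : ℝ) • app D.R₁ us) u
    + (quad D.Q₁ xs + quad D.R₁ us + inner ℝ D.s xs + inner ℝ D.v us + D.c)

/-- `(xt, ut)` minimizes the shifted deterministic stage cost over the solutions of
`(I - A) x - B u = 0`. -/
def IsOptimalShift (xs : Vec n) (us : Vec l) (xt : Vec n) (ut : Vec l) : Prop :=
  app (1 - D.A) xt - app D.B ut = 0 ∧
    ∀ (x : Vec n) (u : Vec l), app (1 - D.A) x - app D.B u = 0 →
      D.shiftedDetCost xs us xt ut ≤ D.shiftedDetCost xs us x u

end LQData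

section Processes

variable {Ω : Type*} [MeasurableSpace Ω]

/-- The covariance matrix of a random vector. -/
def covMatrix {n : ℕ} (Pr : Measure Ω) (X : Ω → Vec n) : Matrix (Fin n) (Fin n) ℝ :=
  Matrix.of fun i j => covariance (fun ω => X ω i) (fun ω => X ω j) Pr

/-- The stochastic stage cost `ℓ(X, U)`. -/
def LQData.stageCost {n l m : ℕ} (D : LQData n l m) (Pr : Measure Ω)
    (X : Ω → Vec n) (U : Ω → Vec l) : ℝ :=
  (∫ ω, (quad D.Q₁ (X ω) + quad D.R₁ (U ω) + inner ℝ D.s (X ω) + inner ℝ D.v (U ω) + D.c) ∂Pr)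
    + (D.Q₂ * covMatrix Pr X).trace + (D.R₂ * covMatrix Pr U).trace

/-- The space of feedback laws: measurable maps `π` with `π ∘ X ∈ L²` for every `X ∈ L²`. -/
def IsFeedbackLaw {n l : ℕ} (Pr : Measure Ω) (π : Vec n → Vec l) : Prop :=
  Measurable π ∧ ∀ X : Ω → Vec n, MemLp X 2 Pr → MemLp (π ∘ X) 2 Pr

/-- `W` is an i.i.d. sequence of square-integrable random vectors with law `ϱW`. -/
structure IsNoise {m : ℕ} (Pr : Measure Ω) (ϱW : ProbabilityMeasure (Vec m))
    (W : ℕ → Ω → Vec m) : Prop where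
  memLp : ∀ k, MemLp (W k) 2 Pr
  hasLaw : ∀ k, HasLaw (W k) (ϱW : Measure (Vec m)) Pr
  indep : iIndepFun W Pr

/-- `(X, U)` is a trajectory of the stochastic system: `X k`, `U k` are square-integrable,
`W k` is independent of `(X k, U k)`, and `X (k+1) = f(X k, U k, W k)` almost surely. -/
structure IsTrajectory {n l m : ℕ} (D : LQData n l m) (Pr : Measure Ω) (W : ℕ → Ω → Vec m)
    (X : ℕ → Ω → Vec n) (U : ℕ → Ω → Vec l) : Prop where
  memLp_X : ∀ k, MemLp (X k) 2 Pr
  memLp_U : ∀ k, MemLp (U k) 2 Pr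
  indep : ∀ k, IndepFun (fun ω => (X k ω, U k ω)) (W k) Pr
  step : ∀ k, X (k + 1) =ᵐ[Pr] fun ω => D.f (X k ω) (U k ω) (W k ω)

/-- `(X, U)` is a stationary pair of state and control processes. -/
def IsStationaryPair {n l m : ℕ} (D : LQData n l m) (Pr : Measure Ω) (W : ℕ → Ω → Vec m)
    (X : ℕ → Ω → Vec n) (U : ℕ → Ω → Vec l) : Prop :=
  IsTrajectory D Pr W X U ∧
    ∃ (ϱX : ProbabilityMeasure (Vec n)) (ϱU : ProbabilityMeasure (Vec l)),
      FiniteSecondMoment ϱX ∧ FiniteSecondMoment ϱU ∧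
        ∀ k, HasLaw (X k) (ϱX : Measure (Vec n)) Pr ∧ HasLaw (U k) (ϱU : Measure (Vec l)) Pr

/-- `(X, U)` is a stationary pair in feedback form with distribution `ϱ` and feedback law `π`. -/
def IsStationaryFeedbackPair {n l m : ℕ} (D : LQData n l m) (Pr : Measure Ω)
    (W : ℕ → Ω → Vec m) (ϱ : ProbabilityMeasure (Vec n)) (π : Vec n → Vec l)
    (X : ℕ → Ω → Vec n) (U : ℕ → Ω → Vec l) : Prop :=
  IsTrajectory D Pr W X U ∧ FiniteSecondMoment ϱ ∧ IsFeedbackLaw Pr π ∧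
    ∀ k, HasLaw (X k) (ϱ : Measure (Vec n)) Pr ∧ U k =ᵐ[Pr] π ∘ X k

/-- `(X, U)` is the stationary pair generated by the affine feedback
`u = K (x - xt - xs) + ut + us`, with the gain `K` obtained from `P`. -/
def IsAffineStationaryPair {n l m : ℕ} (D : LQData n l m) (Pr : Measure Ω) (W : ℕ → Ω → Vec m)
    (P : Matrix (Fin n) (Fin n) ℝ) (xs : Vec n) (us : Vec l) (xt : Vec n) (ut : Vec l)
    (X : ℕ → Ω → Vec n) (U : ℕ → Ω → Vec l) : Prop :=
  IsStationaryPair D Pr W X U ∧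
    ∀ k, U k =ᵐ[Pr] fun ω => app (D.gain P) (X k ω - xt - xs) + ut + us

/-- Constraints of the stationary optimization problem for `(π, ϱ)`, with witnesses `X`, `W`:
`X ∼ ϱ` and `W ∼ ϱW` are independent and `f(X, π ∘ X, W) ∼ ϱ`. -/
structure IsFeasible {n l m : ℕ} (D : LQData n l m) (Pr : Measure Ω)
    (ϱW : ProbabilityMeasure (Vec m)) (ϱ : ProbabilityMeasure (Vec n)) (π : Vec n → Vec l)
    (X : Ω → Vec n) (W : Ω → Vec m) : Prop where
  feedback : IsFeedbackLaw Pr π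
  memLp_X : MemLp X 2 Pr
  memLp_W : MemLp W 2 Pr
  law_X : HasLaw X (ϱ : Measure (Vec n)) Pr
  law_W : HasLaw W (ϱW : Measure (Vec m)) Pr
  indep : IndepFun X W Pr
  law_next : HasLaw (fun ω => D.f (X ω) (π (X ω)) (W ω)) (ϱ : Measure (Vec n)) Pr

/-- `(ϱ, π)` solves the stationary optimization problem: it is feasible and its cost
`ℓ(X, π ∘ X)` is at most the cost of every feasible pair. -/
def IsStationaryOptimal {n l m : ℕ} (D : LQData n l m) (Pr : Measure Ω)
    (ϱW : ProbabilityMeasure (Vec m)) (ϱ : ProbabilityMeasure (Vec n))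
    (π : Vec n → Vec l) : Prop :=
  ∃ (X : Ω → Vec n) (W : Ω → Vec m), IsFeasible D Pr ϱW ϱ π X W ∧
    ∀ (ϱ' : ProbabilityMeasure (Vec n)) (π' : Vec n → Vec l) (X' : Ω → Vec n) (W' : Ω → Vec m),
      IsFeasible D Pr ϱW ϱ' π' X' W' →
        D.stageCost Pr X (π ∘ X) ≤ D.stageCost Pr X' (π' ∘ X')

end Processes

end StochLQ

end

/-!
For a step `X⁺ = f(X, U, W)` that reproduces the law of `X`, completing the square with the Riccati
solution `P` splits the stage cost into the deterministic cost of the steady state `(𝔼 X, 𝔼 U)`, a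
constant caused by the noise, and a weighted mean square of the deviation of `U - 𝔼 U` from
`K (X - 𝔼 X)`. The reference pair minimizes both non-constant parts. The minimizing steady state is
unique by detectability, so every optimal feedback agrees almost surely with the affine one.

Two trajectories driven by the same noise under this affine feedback differ by a solution of
`z⁺ = (A + B K) z`. The Riccati equation makes `P` a Lyapunov function for `A + B K`, which is a
Schur matrix by detectability, so the difference decays geometrically along almost every path.
-/

noncomputable section

namespace StochLQ

section LinearAlgebra

variable {p q r : ℕ}

lemma app_eq_toLp_mulVec (M : Matrix (Fin p) (Fin q) ℝ) (x : Vec q) :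
    app M x = WithLp.toLp 2 (M.mulVec x.ofLp) := rfl

lemma app_apply (M : Matrix (Fin p) (Fin q) ℝ) (x : Vec q) (i : Fin p) :
    app M x i = ∑ j, M i j * x j := rfl

lemma app_add (M : Matrix (Fin p) (Fin q) ℝ) (x y : Vec q) :
    app M (x + y) = app M x + app M y := map_add _ x y

lemma app_sub (M : Matrix (Fin p) (Fin q) ℝ) (x y : Vec q) :
    app M (x - y) = app M x - app M y := map_sub _ x y

lemma app_smul (M : Matrix (Fin p) (Fin q) ℝ) (t : ℝ) (x : Vec q) :
    app M (t • x) = t • app M x := map_smul _ t x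

@[simp] lemma app_zero (M : Matrix (Fin p) (Fin q) ℝ) : app M 0 = 0 := map_zero _

@[simp] lemma one_app (x : Vec p) : app 1 x = x := by simp [app]

lemma add_app (M N : Matrix (Fin p) (Fin q) ℝ) (x : Vec q) :
    app (M + N) x = app M x + app N x := by simp [app]

lemma sub_app (M N : Matrix (Fin p) (Fin q) ℝ) (x : Vec q) :
    app (M - N) x = app M x - app N x := by simp [app]

lemma neg_app (M : Matrix (Fin p) (Fin q) ℝ) (x : Vec q) : app (-M) x = -app M x := by simp [app]

lemma mul_app (M : Matrix (Fin p) (Fin q) ℝ) (N : Matrix (Fin q) (Fin r) ℝ) (x : Vec r) :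
    app (M * N) x = app M (app N x) := by
  simp [app_eq_toLp_mulVec]

/-- The map `x ↦ M x` bundled as a continuous linear map. -/
def appCLM (M : Matrix (Fin p) (Fin q) ℝ) : Vec q →L[ℝ] Vec p :=
  LinearMap.toContinuousLinearMap (Matrix.toEuclideanLin M)

lemma continuous_app (M : Matrix (Fin p) (Fin q) ℝ) : Continuous (app M) :=
  (appCLM M).continuous

lemma inner_app (M : Matrix (Fin p) (Fin q) ℝ) (x : Vec p) (y : Vec q) :
    inner ℝ x (app M y) = inner ℝ (app M.transpose x) y := by
  simp only [app_eq_toLp_mulVec, EuclideanSpace.inner_eq_star_dotProduct, star_trivial,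
    Matrix.mulVec_transpose]
  rw [dotProduct_comm, Matrix.dotProduct_mulVec, dotProduct_comm]

lemma inner_app_comm {M : Matrix (Fin p) (Fin p) ℝ} (hM : M.IsHermitian) (x y : Vec p) :
    inner ℝ x (app M y) = inner ℝ y (app M x) := by
  rw [inner_app, real_inner_comm]
  congr 2

open scoped Matrix.Norms.Frobenius in
lemma norm_app_le (M : Matrix (Fin p) (Fin q) ℝ) (x : Vec q) : ‖app M x‖ ≤ ‖M‖ * ‖x‖ := by
  have h := Matrix.frobenius_norm_mul M (Matrix.replicateCol Unit x.ofLp)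
  rwa [← Matrix.replicateCol_mulVec, Matrix.frobenius_norm_replicateCol,
    Matrix.frobenius_norm_replicateCol] at h

end LinearAlgebra

section QuadraticForm

variable {p q : ℕ}

@[simp] lemma quad_zero (M : Matrix (Fin p) (Fin p) ℝ) : quad M 0 = 0 := by simp [quad]

lemma add_quad (M N : Matrix (Fin p) (Fin p) ℝ) (x : Vec p) :
    quad (M + N) x = quad M x + quad N x := by simp [quad, add_app, inner_add_right]

lemma quad_smul (M : Matrix (Fin p) (Fin p) ℝ) (t : ℝ) (x : Vec p) :
    quad M (t • x) = t ^ 2 * quad M x := by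
  simp only [quad, app_smul, inner_smul_left, inner_smul_right, conj_trivial]
  ring

lemma quad_add (M : Matrix (Fin p) (Fin p) ℝ) (x y : Vec p) :
    quad M (x + y) = quad M x + inner ℝ x (app (M + M.transpose) y) + quad M y := by
  have hswap : inner ℝ y (app M x) = inner ℝ x (app M.transpose y) := by
    rw [inner_app, real_inner_comm]
  simp only [quad, app_add, add_app, inner_add_left, inner_add_right, hswap]
  ring

lemma quad_add_of_isHermitian {M : Matrix (Fin p) (Fin p) ℝ} (hM : M.IsHermitian) (x y : Vec p) :
    quad M (x + y) = quad M x + 2 * inner ℝ x (app M y) + quad M y := by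
  rw [quad_add, show M.transpose = M from hM, add_app, inner_add_right, two_mul]

lemma quad_sub_of_isHermitian {M : Matrix (Fin p) (Fin p) ℝ} (hM : M.IsHermitian) (x y : Vec p) :
    quad M (x - y) = quad M x - 2 * inner ℝ x (app M y) + quad M y := by
  simp only [quad, app_sub, inner_sub_left, inner_sub_right, inner_app_comm hM y x]
  ring

lemma quad_add_add_quad_sub (M : Matrix (Fin p) (Fin p) ℝ) (x y : Vec p) :
    quad M (x + y) + quad M (x - y) = 2 * quad M x + 2 * quad M y := by
  simp only [quad, app_add, app_sub, inner_add_left, inner_add_right, inner_sub_left,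
    inner_sub_right]
  ring

lemma quad_transpose_mul_mul (M : Matrix (Fin p) (Fin p) ℝ) (N : Matrix (Fin p) (Fin q) ℝ)
    (x : Vec q) : quad (N.transpose * M * N) x = quad M (app N x) := by
  simp [quad, mul_app, inner_app]

lemma quad_eq_dotProduct (M : Matrix (Fin p) (Fin p) ℝ) (x : Vec p) :
    quad M x = x.ofLp ⬝ᵥ M.mulVec x.ofLp := by
  rw [quad, app_eq_toLp_mulVec, EuclideanSpace.inner_eq_star_dotProduct, star_trivial,
    dotProduct_comm]

lemma continuous_quad (M : Matrix (Fin p) (Fin p) ℝ) : Continuous (quad M) :=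
  continuous_id.inner (continuous_app M)

lemma quad_nonneg {M : Matrix (Fin p) (Fin p) ℝ} (hM : M.PosSemidef) (x : Vec p) :
    0 ≤ quad M x := by
  simpa [quad_eq_dotProduct] using hM.dotProduct_mulVec_nonneg x.ofLp

lemma quad_eq_zero_iff {M : Matrix (Fin p) (Fin p) ℝ} (hM : M.PosDef) {x : Vec p} :
    quad M x = 0 ↔ x = 0 := by
  refine ⟨fun h => ?_, fun h => h ▸ quad_zero M⟩
  by_contra hx
  have hpos := hM.dotProduct_mulVec_pos (mt (WithLp.ofLp_eq_zero 2).1 hx)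
  rw [star_trivial, ← quad_eq_dotProduct, h] at hpos
  exact hpos.false

lemma app_sqrt_eq_zero_of_quad_eq_zero {M : Matrix (Fin p) (Fin p) ℝ} (hM : M.PosSemidef)
    {x : Vec p} (h : quad M x = 0) : app (CFC.sqrt M) x = 0 := by
  have hsqrt : (CFC.sqrt M).IsHermitian :=
    (Matrix.nonneg_iff_posSemidef.1 (CFC.sqrt_nonneg M)).isHermitian
  rw [← inner_self_eq_zero (𝕜 := ℝ), inner_app_comm hsqrt, ← mul_app,
    CFC.sqrt_mul_sqrt_self M hM.nonneg]
  exact h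

lemma app_sqrt_eq_zero_of_quad_add_eq_zero {M N : Matrix (Fin p) (Fin p) ℝ} (hM : M.PosSemidef)
    (hN : N.PosSemidef) {x : Vec p} (h : quad (M + N) x = 0) : app (CFC.sqrt M) x = 0 := by
  rw [add_quad] at h
  exact app_sqrt_eq_zero_of_quad_eq_zero hM (by linarith [quad_nonneg hM x, quad_nonneg hN x])

end QuadraticForm

section Schur

variable {p : ℕ}

/-- `a + i b` is an eigenvector of the complexification of `M` for the eigenvalue `μ`. It is
encoded by its real and imaginary parts because `app` and `quad` act on real vectors. -/
def IsComplexEigenvector (M : Matrix (Fin p) (Fin p) ℝ) (μ : ℂ) (a b : Vec p) : Prop :=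
  app M a = μ.re • a - μ.im • b ∧ app M b = μ.im • a + μ.re • b ∧ ¬ (a = 0 ∧ b = 0)

lemma map_mulVec_eq_smul_iff (M : Matrix (Fin p) (Fin p) ℝ) (μ : ℂ) (v : Fin p → ℂ) :
    (M.map (algebraMap ℝ ℂ)).mulVec v = μ • v ↔
      app M (WithLp.toLp 2 fun i => (v i).re)
          = μ.re • WithLp.toLp 2 (fun i => (v i).re) - μ.im • WithLp.toLp 2 (fun i => (v i).im) ∧
        app M (WithLp.toLp 2 fun i => (v i).im)
          = μ.im • WithLp.toLp 2 (fun i => (v i).re)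
            + μ.re • WithLp.toLp 2 (fun i => (v i).im) := by
  simp [funext_iff, PiLp.ext_iff, Complex.ext_iff, Matrix.mulVec, dotProduct, app_apply,
    forall_and, add_comm]

lemma mem_spectrum_map_iff_exists_isComplexEigenvector (M : Matrix (Fin p) (Fin p) ℝ) (μ : ℂ) :
    μ ∈ spectrum ℂ (M.map (algebraMap ℝ ℂ)) ↔ ∃ a b, IsComplexEigenvector M μ a b := by
  rw [← Matrix.spectrum_toLin', ← Module.End.hasEigenvalue_iff_mem_spectrum]
  constructor
  · intro h
    obtain ⟨v, hv, hv0⟩ := h.exists_hasEigenvector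
    rw [Module.End.mem_eigenspace_iff, Matrix.toLin'_apply, map_mulVec_eq_smul_iff] at hv
    refine ⟨_, _, hv.1, hv.2, fun h0 => hv0 (funext fun i => Complex.ext ?_ ?_)⟩
    · simpa using congrArg (· i) h0.1
    · simpa using congrArg (· i) h0.2
  · rintro ⟨a, b, ha, hb, hab⟩
    have hv := (map_mulVec_eq_smul_iff M μ fun i => ⟨a i, b i⟩).2 ⟨ha, hb⟩
    refine Module.End.hasEigenvalue_of_hasEigenvector
      ⟨Module.End.mem_eigenspace_iff.2 ((Matrix.toLin'_apply _ _).trans hv), fun h0 => hab ?_⟩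
    constructor <;> ext i
    · simpa using congrArg Complex.re (congrFun h0 i)
    · simpa using congrArg Complex.im (congrFun h0 i)

lemma isSchur_iff_forall_isComplexEigenvector {M : Matrix (Fin p) (Fin p) ℝ} :
    IsSchur M ↔ ∀ μ a b, IsComplexEigenvector M μ a b → ‖μ‖ < 1 := by
  simp only [IsSchur, mem_spectrum_map_iff_exists_isComplexEigenvector, forall_exists_index]

lemma IsSchur.eq_zero_of_app_eq_self {M : Matrix (Fin p) (Fin p) ℝ} (hM : IsSchur M) {x : Vec p}
    (h : app M x = x) : x = 0 := by
  by_contra hx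
  have hlt := isSchur_iff_forall_isComplexEigenvector.1 hM 1 x 0
    ⟨by simpa using h, by simp, fun h0 => hx h0.1⟩
  simp at hlt

lemma IsComplexEigenvector.quad_app_add_quad_app {M : Matrix (Fin p) (Fin p) ℝ} {μ : ℂ}
    {a b : Vec p} (h : IsComplexEigenvector M μ a b) (P : Matrix (Fin p) (Fin p) ℝ) :
    quad P (app M a) + quad P (app M b) = ‖μ‖ ^ 2 * (quad P a + quad P b) := by
  rw [h.1, h.2.1, ← Complex.normSq_eq_norm_sq, Complex.normSq_apply]
  simp only [quad, app_add, app_sub, app_smul, inner_add_left, inner_add_right, inner_sub_left,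
    inner_sub_right, inner_smul_left, inner_smul_right, conj_trivial]
  ring

/-- An eigenvector of `M` with `1 ≤ ‖μ‖` does not decrease `P`, so it lies in the kernel of `S`,
where it is also an eigenvector of `N`. -/
lemma IsSchur.of_quad_eq_add {M N P S : Matrix (Fin p) (Fin p) ℝ} (hN : IsSchur N)
    (hP : P.PosSemidef) (hS : S.PosSemidef) (hPS : ∀ x, quad P x = quad S x + quad P (app M x))
    (hMN : ∀ x, quad S x = 0 → app M x = app N x) : IsSchur M := by
  rw [isSchur_iff_forall_isComplexEigenvector] at hN ⊢
  intro μ a b h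
  by_contra! hμ
  have hgrow : quad P a + quad P b ≤ ‖μ‖ ^ 2 * (quad P a + quad P b) :=
    le_mul_of_one_le_left (add_nonneg (quad_nonneg hP a) (quad_nonneg hP b)) (one_le_pow₀ hμ)
  rw [← h.quad_app_add_quad_app] at hgrow
  have hSa : quad S a = 0 := by linarith [hPS a, hPS b, quad_nonneg hS a, quad_nonneg hS b]
  have hSb : quad S b = 0 := by linarith [hPS a, hPS b, quad_nonneg hS a, quad_nonneg hS b]
  exact (hN μ a b ⟨hMN a hSa ▸ h.1, hMN b hSb ▸ h.2.1, h.2.2⟩).not_ge hμ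

lemma exists_norm_pow_le_of_spectralRadius_lt_one {𝔸 : Type*} [NormedRing 𝔸] [NormedAlgebra ℂ 𝔸]
    [CompleteSpace 𝔸] {a : 𝔸} (ha : spectralRadius ℂ a < 1) :
    ∃ C, ∃ r ∈ Set.Ico (0 : ℝ) 1, ∀ k : ℕ, ‖a ^ k‖ ≤ C * r ^ k := by
  obtain ⟨r, har, hr1⟩ := ENNReal.lt_iff_exists_nnreal_btwn.1 ha
  have hr0 : r ≠ 0 := by
    rintro rfl
    exact not_lt_zero har
  have hgelfand : ∀ᶠ k : ℕ in atTop, ‖a ^ k‖ ≤ 1 * ‖(r : ℝ) ^ k‖ := by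
    filter_upwards [(spectrum.pow_nnnorm_pow_one_div_tendsto_nhds_spectralRadius
      a).eventually_lt_const har, eventually_ne_atTop 0] with k hk hk0
    have hpow := ENNReal.rpow_le_rpow hk.le (Nat.cast_nonneg (α := ℝ) k)
    rw [← ENNReal.rpow_mul, one_div, inv_mul_cancel₀ (Nat.cast_ne_zero.2 hk0), ENNReal.rpow_one,
      ENNReal.rpow_natCast] at hpow
    rw [one_mul, Real.norm_of_nonneg (by positivity)]
    exact_mod_cast hpow
  obtain ⟨C, -, hbound⟩ := Asymptotics.bound_of_isBigO_nat_atTop (.of_bound 1 hgelfand)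
  refine ⟨C, r, ⟨r.coe_nonneg, mod_cast hr1⟩, fun k => ?_⟩
  simpa using hbound (x := k) (pow_ne_zero k (NNReal.coe_ne_zero.2 hr0))

open scoped Matrix.Norms.Frobenius in
lemma IsSchur.spectralRadius_lt_one {M : Matrix (Fin p) (Fin p) ℝ} (hM : IsSchur M) :
    spectralRadius ℂ (M.map (algebraMap ℝ ℂ)) < 1 := by
  rcases (spectrum ℂ (M.map (algebraMap ℝ ℂ))).eq_empty_or_nonempty with hempty | hne
  · rw [spectralRadius, hempty]
    simp
  · exact_mod_cast spectrum.spectralRadius_lt_of_forall_lt_of_nonempty (r := 1) hne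
      fun μ hμ => by exact_mod_cast hM μ hμ

open scoped Matrix.Norms.Frobenius in
/-- Gelfand's formula only concerns complex algebras; the Frobenius norm does not change under
complexification. -/
lemma IsSchur.exists_norm_pow_le {M : Matrix (Fin p) (Fin p) ℝ} (hM : IsSchur M) :
    ∃ C, ∃ r ∈ Set.Ico (0 : ℝ) 1, ∀ k : ℕ, ‖M ^ k‖ ≤ C * r ^ k := by
  obtain ⟨C, r, hr, hbound⟩ :=
    exists_norm_pow_le_of_spectralRadius_lt_one hM.spectralRadius_lt_one
  refine ⟨C, r, hr, fun k => ?_⟩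
  have hmap : (M.map (algebraMap ℝ ℂ)) ^ k = (M ^ k).map (algebraMap ℝ ℂ) :=
    (map_pow (algebraMap ℝ ℂ).mapMatrix M k).symm
  rw [← Matrix.frobenius_norm_map_eq (M ^ k) (algebraMap ℝ ℂ) fun x => Complex.norm_real x, ← hmap]
  exact hbound k

lemma IsSchur.exists_norm_le_of_forall_succ_eq_app {M : Matrix (Fin p) (Fin p) ℝ}
    (hM : IsSchur M) :
    ∃ C, ∃ r ∈ Set.Ico (0 : ℝ) 1, ∀ x : ℕ → Vec p, (∀ k, x (k + 1) = app M (x k)) →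
      ∀ k, ‖x k‖ ≤ C * r ^ k * ‖x 0‖ := by
  obtain ⟨C, r, hr, hbound⟩ := hM.exists_norm_pow_le
  refine ⟨C, r, hr, fun x hx k => ?_⟩
  have hpow : x k = app (M ^ k) (x 0) := by
    induction k with
    | zero => simp
    | succ k ih => rw [hx, ih, pow_succ', mul_app]
  rw [hpow]
  exact (norm_app_le _ _).trans (mul_le_mul_of_nonneg_right (hbound k) (norm_nonneg _))

end Schur

section Riccati

variable {n l q : ℕ} {A P Q : Matrix (Fin n) (Fin n) ℝ} {B : Matrix (Fin n) (Fin l) ℝ}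
  {R : Matrix (Fin l) (Fin l) ℝ}

/-- The weight `R + Bᵀ P B` of the control in the cost-to-go of the linear-quadratic problem with
value function `P`. -/
def inputWeight (B : Matrix (Fin n) (Fin l) ℝ) (R : Matrix (Fin l) (Fin l) ℝ)
    (P : Matrix (Fin n) (Fin n) ℝ) : Matrix (Fin l) (Fin l) ℝ :=
  R + B.transpose * P * B

/-- The optimal gain `-(R + Bᵀ P B)⁻¹ Bᵀ P A` of the linear-quadratic problem with value function
`P`. -/
def riccatiGain (A : Matrix (Fin n) (Fin n) ℝ) (B : Matrix (Fin n) (Fin l) ℝ)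
    (R : Matrix (Fin l) (Fin l) ℝ) (P : Matrix (Fin n) (Fin n) ℝ) : Matrix (Fin l) (Fin n) ℝ :=
  -((inputWeight B R P)⁻¹ * B.transpose * P * A)

/-- `P` solves the discrete-time algebraic Riccati equation with state weight `Q` and control
weight `R`. The inverse is meaningful only if `inputWeight B R P` is invertible. -/
def SolvesRiccati (A : Matrix (Fin n) (Fin n) ℝ) (B : Matrix (Fin n) (Fin l) ℝ)
    (Q : Matrix (Fin n) (Fin n) ℝ) (R : Matrix (Fin l) (Fin l) ℝ)
    (P : Matrix (Fin n) (Fin n) ℝ) : Prop :=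
  P = A.transpose * P * A + Q -
    A.transpose * P * B * (inputWeight B R P)⁻¹ * B.transpose * P * A

lemma posDef_inputWeight (hR : R.PosDef) (hP : P.PosSemidef) : (inputWeight B R P).PosDef := by
  refine hR.add_posSemidef ?_
  simpa using hP.conjTranspose_mul_mul_same B

lemma quad_inputWeight (u : Vec l) :
    quad (inputWeight B R P) u = quad R u + quad P (app B u) := by
  rw [inputWeight, add_quad, quad_transpose_mul_mul]

lemma app_inputWeight_app_riccatiGain (hS : IsUnit (inputWeight B R P)) (x : Vec n) :
    app (inputWeight B R P) (app (riccatiGain A B R P) x)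
      = -app B.transpose (app P (app A x)) := by
  have hmul : inputWeight B R P * riccatiGain A B R P = -(B.transpose * P * A) := by
    rw [riccatiGain, Matrix.mul_neg, Matrix.mul_assoc, Matrix.mul_assoc,
      Matrix.mul_nonsing_inv_cancel_left _ _ ((Matrix.isUnit_iff_isUnit_det _).1 hS),
      ← Matrix.mul_assoc]
  rw [← mul_app, hmul, neg_app, mul_app, mul_app]

lemma SolvesRiccati.quad_eq (h : SolvesRiccati A B Q R P) (x : Vec n) :
    quad P x = quad P (app A x) + quad Q x
      + inner ℝ (app A x) (app P (app B (app (riccatiGain A B R P) x))) := by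
  have hgain : P = A.transpose * P * A + Q + A.transpose * P * B * riccatiGain A B R P := by
    rw [riccatiGain, Matrix.mul_neg, ← sub_eq_add_neg]
    simpa only [SolvesRiccati, Matrix.mul_assoc] using h
  conv_lhs => rw [hgain]
  rw [add_quad, add_quad, quad_transpose_mul_mul]
  congr 1
  simp [quad, mul_app, inner_app A.transpose]

lemma SolvesRiccati.complete_square (h : SolvesRiccati A B Q R P)
    (hP : P.PosSemidef) (hR : R.PosDef) (x : Vec n) (u : Vec l) :
    quad Q x + quad R u + quad P (app A x + app B u)
      = quad P x + quad (inputWeight B R P) (u - app (riccatiGain A B R P) x) := by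
  have hS := posDef_inputWeight (B := B) hR hP
  have hcross : ∀ w : Vec l, inner ℝ w (app B.transpose (app P (app A x)))
      = inner ℝ (app A x) (app P (app B w)) := fun w => by
    rw [inner_app, Matrix.transpose_transpose, inner_app_comm hP.isHermitian]
  rw [quad_sub_of_isHermitian hS.isHermitian, quad_inputWeight,
    quad_add_of_isHermitian hP.isHermitian, h.quad_eq x, quad.eq_1 (inputWeight B R P),
    app_inputWeight_app_riccatiGain hS.isUnit, inner_neg_right, inner_neg_right, hcross, hcross]
  ring

theorem SolvesRiccati.isSchur_add_mul_riccatiGain (h : SolvesRiccati A B Q R P)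
    (hP : P.PosSemidef) (hQ : Q.PosSemidef) (hR : R.PosDef) {C : Matrix (Fin q) (Fin n) ℝ}
    (hC : ∀ x, quad Q x = 0 → app C x = 0) (hAC : Detectable A C) :
    IsSchur (A + B * riccatiGain A B R P) := by
  set K := riccatiGain A B R P
  obtain ⟨L, hL⟩ := hAC
  have hquad : ∀ x, quad (Q + K.transpose * R * K) x = quad Q x + quad R (app K x) := fun x => by
    rw [add_quad, quad_transpose_mul_mul]
  refine hL.of_quad_eq_add (S := Q + K.transpose * R * K) hP (hQ.add ?_)
    (fun x => ?_) (fun x hx => ?_)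
  · simpa using hR.posSemidef.conjTranspose_mul_mul_same K
  · have hsquare := h.complete_square hP hR x (app K x)
    rw [sub_self, quad_zero, add_zero] at hsquare
    rw [hquad, ← hsquare, add_app, mul_app]
  · rw [hquad] at hx
    have hQx := quad_nonneg hQ x
    have hRx := quad_nonneg hR.posSemidef (app K x)
    have hKx : app K x = 0 := (quad_eq_zero_iff hR).1 (by linarith)
    have hCx : app C x = 0 := hC x (by linarith)
    rw [add_app, add_app, mul_app, mul_app, hKx, hCx, app_zero, app_zero]

end Riccati

namespace LQData

variable {n l m : ℕ} {D : LQData n l m}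

lemma f_sub_f (x x' : Vec n) (u u' : Vec l) (w w' : Vec m) :
    D.f x u w - D.f x' u' w' = app D.A (x - x') + app D.B (u - u') + app D.E (w - w') := by
  simp only [f, app_sub]
  abel

lemma IsRiccati.isSchur_add_mul_gain {q : ℕ} {C : Matrix (Fin q) (Fin n) ℝ}
    {P : Matrix (Fin n) (Fin n) ℝ} (hP : D.IsRiccati P) (hQ : (D.Q₁ + D.Q₂).PosSemidef)
    (hR : (D.R₁ + D.R₂).PosDef) (hC : ∀ x, quad (D.Q₁ + D.Q₂) x = 0 → app C x = 0)
    (hAC : Detectable D.A C) : IsSchur (D.A + D.B * D.gain P) :=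
  SolvesRiccati.isSchur_add_mul_riccatiGain hP.2 hP.1 hQ hR hC hAC

end LQData

section SteadyState

namespace LQData

variable {n l m : ℕ} (D : LQData n l m)

/-- The deterministic stage cost `xᵀ Q₁ x + uᵀ R₁ u + sᵀ x + vᵀ u + c`. -/
def detCost (x : Vec n) (u : Vec l) : ℝ :=
  quad D.Q₁ x + quad D.R₁ u + inner ℝ D.s x + inner ℝ D.v u + D.c

/-- `(x, u)` minimizes the deterministic stage cost over the steady states for the constant
disturbance `μW`. -/
structure IsOptimalSteadyState (μW : Vec m) (x : Vec n) (u : Vec l) : Prop where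
  isSteadyState : D.IsSteadyState μW x u
  detCost_le : ∀ x' u', D.IsSteadyState μW x' u' → D.detCost x u ≤ D.detCost x' u'

variable {D} {μW : Vec m} {x x' : Vec n} {u u' : Vec l}

lemma isSteadyState_iff_f_eq : D.IsSteadyState μW x u ↔ D.f x u μW = x := by
  rw [IsSteadyState, f, sub_app, one_app, sub_eq_iff_eq_add, sub_eq_iff_eq_add, eq_comm]
  refine Eq.congr_left ?_
  abel

lemma IsSteadyState.add_iff (h : D.IsSteadyState μW x u) :
    D.IsSteadyState μW (x + x') (u + u') ↔ app (1 - D.A) x' - app D.B u' = 0 := by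
  rw [IsSteadyState, app_add, app_add, add_sub_add_comm, h, add_eq_left]

lemma IsSteadyState.midpoint (h : D.IsSteadyState μW x u) (h' : D.IsSteadyState μW x' u') :
    D.IsSteadyState μW ((2⁻¹ : ℝ) • (x + x')) ((2⁻¹ : ℝ) • (u + u')) := by
  rw [IsSteadyState, app_smul, app_smul, ← smul_sub, app_add, app_add, add_sub_add_comm, h, h',
    ← two_smul ℝ, inv_smul_smul₀ two_ne_zero]

lemma detCost_midpoint (x x' : Vec n) (u u' : Vec l) :
    D.detCost ((2⁻¹ : ℝ) • (x + x')) ((2⁻¹ : ℝ) • (u + u'))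
      = (D.detCost x u + D.detCost x' u') / 2 - (quad D.Q₁ (x - x') + quad D.R₁ (u - u')) / 4 := by
  have hQ := quad_add_add_quad_sub D.Q₁ x x'
  have hR := quad_add_add_quad_sub D.R₁ u u'
  simp only [detCost, quad_smul, inner_smul_right, inner_add_right]
  linarith

lemma shiftedDetCost_eq_detCost_add (hQ : D.Q₁.IsHermitian) (hR : D.R₁.IsHermitian)
    (x x' : Vec n) (u u' : Vec l) :
    D.shiftedDetCost x u x' u' = D.detCost (x + x') (u + u') := by
  simp only [shiftedDetCost, detCost, quad_add_of_isHermitian hQ, quad_add_of_isHermitian hR,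
    inner_add_left, inner_add_right, inner_smul_left, inner_app_comm hQ x x',
    inner_app_comm hR u u', real_inner_comm x' (app D.Q₁ x), real_inner_comm u' (app D.R₁ u),
    conj_trivial]
  ring

lemma IsOptimalShift.isOptimalSteadyState (h : D.IsOptimalShift x u x' u')
    (hs : D.IsSteadyState μW x u) (hQ : D.Q₁.IsHermitian) (hR : D.R₁.IsHermitian) :
    D.IsOptimalSteadyState μW (x + x') (u + u') := by
  refine ⟨hs.add_iff.2 h.1, fun y v hyv => ?_⟩
  have hle := h.2 (y - x) (v - u) (hs.add_iff.1 (by rwa [add_sub_cancel, add_sub_cancel]))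
  rwa [shiftedDetCost_eq_detCost_add hQ hR, shiftedDetCost_eq_detCost_add hQ hR, add_sub_cancel,
    add_sub_cancel] at hle

/-- The parallelogram identity at the midpoint forces two optimal steady states to differ only in
directions that the cost does not see; detectability excludes those. -/
lemma IsOptimalSteadyState.eq_of_detCost_le (h : D.IsOptimalSteadyState μW x u)
    (hQ : D.Q₁.PosSemidef) (hR : D.R₁.PosDef) (hdetect : Detectable D.A (CFC.sqrt D.Q₁))
    (h' : D.IsSteadyState μW x' u') (hle : D.detCost x' u' ≤ D.detCost x u) :
    x' = x ∧ u' = u := by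
  obtain ⟨L, hL⟩ := hdetect
  have hmid := h.detCost_le _ _ (h'.midpoint h.isSteadyState)
  rw [detCost_midpoint] at hmid
  have hQd := quad_nonneg hQ (x' - x)
  have hRd := quad_nonneg hR.posSemidef (u' - u)
  have hu : u' = u := sub_eq_zero.1 ((quad_eq_zero_iff hR).1 (by linarith))
  have hsqrt : app (CFC.sqrt D.Q₁) (x' - x) = 0 :=
    app_sqrt_eq_zero_of_quad_eq_zero hQ (by linarith)
  have hA : app D.A (x' - x) = x' - x := by
    have hf := f_sub_f (D := D) x' x u' u μW μW
    rw [isSteadyState_iff_f_eq.1 h', isSteadyState_iff_f_eq.1 h.isSteadyState, hu] at hf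
    simpa using hf.symm
  have hx : x' - x = 0 := hL.eq_zero_of_app_eq_self (by simp [add_app, mul_app, hsqrt, hA])
  exact ⟨sub_eq_zero.1 hx, hu⟩

end LQData

end SteadyState

section Moments

variable {Ω : Type*} [MeasurableSpace Ω] {Pr : Measure Ω} {p q : ℕ}

lemma memLp_app (M : Matrix (Fin p) (Fin q) ℝ) {X : Ω → Vec q} {r : ENNReal} (hX : MemLp X r Pr) :
    MemLp (fun ω => app M (X ω)) r Pr :=
  (appCLM M).comp_memLp' hX

lemma integrable_app (M : Matrix (Fin p) (Fin q) ℝ) {X : Ω → Vec q} (hX : Integrable X Pr) :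
    Integrable (fun ω => app M (X ω)) Pr :=
  (appCLM M).integrable_comp hX

lemma integrable_inner {X Y : Ω → Vec p} (hX : MemLp X 2 Pr) (hY : MemLp Y 2 Pr) :
    Integrable (fun ω => inner ℝ (X ω) (Y ω)) Pr := by
  refine (hX.norm.integrable_mul hY.norm).mono' (hX.1.inner hY.1) (ae_of_all _ fun ω => ?_)
  exact abs_real_inner_le_norm (X ω) (Y ω)

lemma integrable_quad (M : Matrix (Fin p) (Fin p) ℝ) {X : Ω → Vec p} (hX : MemLp X 2 Pr) :
    Integrable (fun ω => quad M (X ω)) Pr :=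
  integrable_inner hX (memLp_app M hX)

lemma integral_app (M : Matrix (Fin p) (Fin q) ℝ) {X : Ω → Vec q} (hX : Integrable X Pr) :
    ∫ ω, app M (X ω) ∂Pr = app M Pr[X] :=
  (appCLM M).integral_comp_comm hX

lemma trace_mul_covMatrix [IsFiniteMeasure Pr] (M : Matrix (Fin p) (Fin p) ℝ) {X : Ω → Vec p}
    (hX : MemLp X 2 Pr) :
    (M * covMatrix Pr X).trace = ∫ ω, quad M (X ω - Pr[X]) ∂Pr := by
  have hξ : MemLp (fun ω => X ω - Pr[X]) 2 Pr := hX.sub (memLp_const _)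
  have hcoord : ∀ i, MemLp (fun ω => (X ω - Pr[X]) i) 2 Pr := fun i =>
    (EuclideanSpace.proj (𝕜 := ℝ) i).comp_memLp' hξ
  have hmean : ∀ i, ∫ ω, X ω i ∂Pr = Pr[X] i := fun i =>
    (EuclideanSpace.proj (𝕜 := ℝ) i).integral_comp_comm (hX.integrable one_le_two)
  have hint : ∀ i j, Integrable (fun ω => M i j * ((X ω - Pr[X]) j * (X ω - Pr[X]) i)) Pr :=
    fun i j => ((hcoord j).integrable_mul (hcoord i)).const_mul _
  have hquad : ∀ x : Vec p, quad M x = ∑ i, ∑ j, M i j * (x j * x i) := fun x => by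
    simp only [quad_eq_dotProduct, dotProduct, Matrix.mulVec, Finset.mul_sum]
    exact Finset.sum_congr rfl fun i _ => Finset.sum_congr rfl fun j _ => by ring
  simp only [hquad]
  rw [integral_finsetSum _ fun i _ => integrable_finsetSum _ fun j _ => hint i j]
  simp only [Matrix.trace, Matrix.diag_apply, Matrix.mul_apply]
  refine Finset.sum_congr rfl fun i _ => ?_
  rw [integral_finsetSum _ fun j _ => hint i j]
  refine Finset.sum_congr rfl fun j _ => ?_
  simp only [integral_const_mul, covMatrix, Matrix.of_apply, covariance, hmean, PiLp.sub_apply]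

variable [IsProbabilityMeasure Pr]

lemma integral_sub_integral {X : Ω → Vec p} (hX : Integrable X Pr) :
    ∫ ω, (X ω - Pr[X]) ∂Pr = 0 := by
  rw [integral_sub hX (integrable_const _)]
  simp

lemma integral_quad_add_of_indepFun (M : Matrix (Fin p) (Fin p) ℝ) {Y Z : Ω → Vec p}
    (hY : MemLp Y 2 Pr) (hZ : MemLp Z 2 Pr) (hYZ : IndepFun Y Z Pr) (hZ0 : Pr[Z] = 0) :
    ∫ ω, quad M (Y ω + Z ω) ∂Pr = ∫ ω, quad M (Y ω) ∂Pr + ∫ ω, quad M (Z ω) ∂Pr := by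
  set N := M + M.transpose
  have hNZ := memLp_app N hZ
  have hcross : ∫ ω, inner ℝ (Y ω) (app N (Z ω)) ∂Pr = 0 := by
    have hbilin := (hYZ.comp measurable_id (continuous_app N).measurable).integral_bilin
      (hY.integrable one_le_two) (hNZ.integrable one_le_two)
      (innerSL ℝ : Vec p →L[ℝ] Vec p →L[ℝ] ℝ)
    simp only [Function.comp_def, integral_app N (hZ.integrable one_le_two), hZ0, app_zero,
      map_zero] at hbilin
    exact hbilin
  simp only [quad_add]
  rw [integral_add ((integrable_quad M hY).fun_add (integrable_inner hY hNZ))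
      (integrable_quad M hZ),
    integral_add (integrable_quad M hY) (integrable_inner hY hNZ), hcross, add_zero]

lemma integral_quad_eq_quad_integral_add (M : Matrix (Fin p) (Fin p) ℝ) {X : Ω → Vec p}
    (hX : MemLp X 2 Pr) :
    ∫ ω, quad M (X ω) ∂Pr = quad M Pr[X] + ∫ ω, quad M (X ω - Pr[X]) ∂Pr := by
  have h := integral_quad_add_of_indepFun M (memLp_const Pr[X]) (hX.sub (memLp_const Pr[X]))
    (indepFun_const_left _ _) (integral_sub_integral (hX.integrable one_le_two))
  simpa using h

namespace LQData

variable {n l m : ℕ} (D : LQData n l m)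

lemma integral_f {X : Ω → Vec n} {U : Ω → Vec l} {W : Ω → Vec m} (hX : Integrable X Pr)
    (hU : Integrable U Pr) (hW : Integrable W Pr) :
    ∫ ω, D.f (X ω) (U ω) (W ω) ∂Pr = D.f Pr[X] Pr[U] Pr[W] := by
  have hAX := integrable_app D.A hX
  have hBU := integrable_app D.B hU
  have hEW := integrable_app D.E hW
  calc ∫ ω, D.f (X ω) (U ω) (W ω) ∂Pr
      = ∫ ω, app D.A (X ω) ∂Pr + ∫ ω, app D.B (U ω) ∂Pr + ∫ ω, app D.E (W ω) ∂Pr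
          + ∫ _, D.z ∂Pr := by
        rw [← integral_add hAX hBU, ← integral_add (hAX.fun_add hBU) hEW,
          ← integral_add ((hAX.fun_add hBU).fun_add hEW) (integrable_const _)]
        rfl
    _ = D.f Pr[X] Pr[U] Pr[W] := by
        rw [integral_app _ hX, integral_app _ hU, integral_app _ hW, integral_const, probReal_univ,
          one_smul, f]

lemma stageCost_eq_detCost_add {X : Ω → Vec n} {U : Ω → Vec l} (hX : MemLp X 2 Pr)
    (hU : MemLp U 2 Pr) :
    D.stageCost Pr X U = D.detCost Pr[X] Pr[U]
      + ∫ ω, quad (D.Q₁ + D.Q₂) (X ω - Pr[X]) ∂Pr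
      + ∫ ω, quad (D.R₁ + D.R₂) (U ω - Pr[U]) ∂Pr := by
  have hξ : MemLp (fun ω => X ω - Pr[X]) 2 Pr := hX.sub (memLp_const _)
  have hη : MemLp (fun ω => U ω - Pr[U]) 2 Pr := hU.sub (memLp_const _)
  have hXi := hX.integrable one_le_two
  have hUi := hU.integrable one_le_two
  have hQX := integrable_quad D.Q₁ hX
  have hRU := integrable_quad D.R₁ hU
  have hsX : Integrable (fun ω => inner ℝ D.s (X ω)) Pr := hXi.const_inner D.s
  have hvU : Integrable (fun ω => inner ℝ D.v (U ω)) Pr := hUi.const_inner D.v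
  have hlinear : ∫ ω, (quad D.Q₁ (X ω) + quad D.R₁ (U ω) + inner ℝ D.s (X ω)
        + inner ℝ D.v (U ω) + D.c) ∂Pr
      = D.detCost Pr[X] Pr[U] + ∫ ω, quad D.Q₁ (X ω - Pr[X]) ∂Pr
        + ∫ ω, quad D.R₁ (U ω - Pr[U]) ∂Pr := by
    rw [integral_add (((hQX.fun_add hRU).fun_add hsX).fun_add hvU) (integrable_const _),
      integral_add ((hQX.fun_add hRU).fun_add hsX) hvU, integral_add (hQX.fun_add hRU) hsX,
      integral_add hQX hRU, integral_inner hXi, integral_inner hUi,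
      integral_quad_eq_quad_integral_add D.Q₁ hX, integral_quad_eq_quad_integral_add D.R₁ hU,
      integral_const, probReal_univ, one_smul, detCost]
    ring
  simp only [add_quad]
  rw [stageCost, hlinear, trace_mul_covMatrix _ hX, trace_mul_covMatrix _ hU,
    integral_add (integrable_quad D.Q₁ hξ) (integrable_quad D.Q₂ hξ),
    integral_add (integrable_quad D.R₁ hη) (integrable_quad D.R₂ hη)]
  ring

end LQData

end Moments

section StationaryStep

variable {Ω : Type*} [MeasurableSpace Ω] {Pr : Measure Ω} {n l m : ℕ} {D : LQData n l m}
  {ϱW : ProbabilityMeasure (Vec m)} {P : Matrix (Fin n) (Fin n) ℝ} {x : Vec n} {u : Vec l}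

/-- One step of the dynamics that reproduces the law of the state. The control `U` need not be a
function of the state `X`. -/
structure IsStationaryStep (D : LQData n l m) (Pr : Measure Ω) (ϱW : ProbabilityMeasure (Vec m))
    (X : Ω → Vec n) (U : Ω → Vec l) (W : Ω → Vec m) : Prop where
  memLp_X : MemLp X 2 Pr
  memLp_U : MemLp U 2 Pr
  memLp_W : MemLp W 2 Pr
  law_W : HasLaw W (ϱW : Measure (Vec m)) Pr
  indep : IndepFun (fun ω => (X ω, U ω)) W Pr
  identDistrib : IdentDistrib (fun ω => D.f (X ω) (U ω) (W ω)) X Pr Pr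

/-- The affine feedback law with gain `K` through the point `(x, u)`. -/
def affineFeedback (K : Matrix (Fin l) (Fin n) ℝ) (x : Vec n) (u : Vec l) (y : Vec n) : Vec l :=
  app K (y - x) + u

lemma continuous_affineFeedback (K : Matrix (Fin l) (Fin n) ℝ) (x : Vec n) (u : Vec l) :
    Continuous (affineFeedback K x u) :=
  ((continuous_app K).comp (continuous_id.sub continuous_const)).add continuous_const

namespace LQData

/-- The contribution `∫ ‖E (w - μ_W)‖²_P dϱW` of the noise to the stationary cost. -/
def noiseCost (D : LQData n l m) (ϱW : ProbabilityMeasure (Vec m)) (P : Matrix (Fin n) (Fin n) ℝ) :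
    ℝ :=
  ∫ w, quad P (app D.E (w - mean ϱW)) ∂(ϱW : Measure (Vec m))

/-- The mean weighted square of the deviation of the centred control from the Riccati feedback
applied to the centred state. -/
def deviationCost (D : LQData n l m) (Pr : Measure Ω) (P : Matrix (Fin n) (Fin n) ℝ)
    (X : Ω → Vec n) (U : Ω → Vec l) : ℝ :=
  ∫ ω, quad (inputWeight D.B (D.R₁ + D.R₂) P)
    (U ω - Pr[U] - app (D.gain P) (X ω - Pr[X])) ∂Pr

lemma deviationCost_nonneg (hP : P.PosSemidef) (hR : (D.R₁ + D.R₂).PosDef) (X : Ω → Vec n)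
    (U : Ω → Vec l) : 0 ≤ D.deviationCost Pr P X U :=
  integral_nonneg fun _ => quad_nonneg (posDef_inputWeight hR hP).posSemidef _

lemma deviationCost_eq_zero_iff [IsFiniteMeasure Pr] (hP : P.PosSemidef)
    (hR : (D.R₁ + D.R₂).PosDef) {X : Ω → Vec n} {U : Ω → Vec l} (hX : MemLp X 2 Pr)
    (hU : MemLp U 2 Pr) :
    D.deviationCost Pr P X U = 0 ↔ U =ᵐ[Pr] affineFeedback (D.gain P) Pr[X] Pr[U] ∘ X := by
  have hS := posDef_inputWeight (B := D.B) hR hP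
  have hdev : MemLp (fun ω => U ω - Pr[U] - app (D.gain P) (X ω - Pr[X])) 2 Pr :=
    (hU.sub (memLp_const _)).sub (memLp_app _ (hX.sub (memLp_const _)))
  rw [deviationCost, integral_eq_zero_iff_of_nonneg (fun ω => quad_nonneg hS.posSemidef _)
    (integrable_quad _ hdev)]
  refine Filter.eventually_congr (ae_of_all _ fun ω => ?_)
  simp only [Pi.zero_apply, quad_eq_zero_iff hS]
  rw [sub_eq_zero, sub_eq_iff_eq_add]
  rfl

end LQData

namespace IsStationaryStep

variable {X X' : Ω → Vec n} {U U' : Ω → Vec l} {W W' : Ω → Vec m}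

lemma integral_W (h : IsStationaryStep D Pr ϱW X U W) : Pr[W] = mean ϱW :=
  h.law_W.integral_eq

variable [IsProbabilityMeasure Pr]

lemma f_integral (h : IsStationaryStep D Pr ϱW X U W) :
    D.f Pr[X] Pr[U] (mean ϱW) = Pr[X] := by
  rw [← h.integral_W, ← D.integral_f (h.memLp_X.integrable one_le_two)
    (h.memLp_U.integrable one_le_two) (h.memLp_W.integrable one_le_two)]
  exact h.identDistrib.integral_eq

lemma integral_quad_sub_integral (h : IsStationaryStep D Pr ϱW X U W)
    (M : Matrix (Fin n) (Fin n) ℝ) :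
    ∫ ω, quad M (X ω - Pr[X]) ∂Pr
      = ∫ ω, quad M (app D.A (X ω - Pr[X]) + app D.B (U ω - Pr[U])) ∂Pr + D.noiseCost ϱW M := by
  have hdrift : MemLp (fun ω => app D.A (X ω - Pr[X]) + app D.B (U ω - Pr[U])) 2 Pr :=
    (memLp_app D.A (h.memLp_X.sub (memLp_const _))).add
      (memLp_app D.B (h.memLp_U.sub (memLp_const _)))
  have hcentred : MemLp (fun ω => W ω - mean ϱW) 2 Pr := h.memLp_W.sub (memLp_const _)
  have hnoise0 : ∫ ω, app D.E (W ω - mean ϱW) ∂Pr = 0 := by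
    rw [integral_app _ (hcentred.integrable one_le_two), ← h.integral_W,
      integral_sub_integral (h.memLp_W.integrable one_le_two), app_zero]
  have hindep : IndepFun (fun ω => app D.A (X ω - Pr[X]) + app D.B (U ω - Pr[U]))
      (fun ω => app D.E (W ω - mean ϱW)) Pr :=
    h.indep.comp (φ := fun y : Vec n × Vec l => app D.A (y.1 - Pr[X]) + app D.B (y.2 - Pr[U]))
      (ψ := fun w => app D.E (w - mean ϱW))
      (((continuous_app D.A).comp (continuous_fst.sub continuous_const)).add
        ((continuous_app D.B).comp (continuous_snd.sub continuous_const))).measurable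
      ((continuous_app D.E).comp (continuous_id.sub continuous_const)).measurable
  have hquad : Continuous fun y : Vec n => quad M (y - Pr[X]) :=
    (continuous_quad M).comp (continuous_id.sub continuous_const)
  have hnoise : Continuous fun w : Vec m => quad M (app D.E (w - mean ϱW)) :=
    (continuous_quad M).comp ((continuous_app D.E).comp (continuous_id.sub continuous_const))
  calc ∫ ω, quad M (X ω - Pr[X]) ∂Pr
      = ∫ ω, quad M (D.f (X ω) (U ω) (W ω) - Pr[X]) ∂Pr :=
        (h.identDistrib.comp hquad.measurable).integral_eq.symm
    _ = ∫ ω, quad M (app D.A (X ω - Pr[X]) + app D.B (U ω - Pr[U])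
          + app D.E (W ω - mean ϱW)) ∂Pr := by
        simp only [← LQData.f_sub_f, h.f_integral]
    _ = ∫ ω, quad M (app D.A (X ω - Pr[X]) + app D.B (U ω - Pr[U])) ∂Pr
          + ∫ ω, quad M (app D.E (W ω - mean ϱW)) ∂Pr :=
        integral_quad_add_of_indepFun M hdrift (memLp_app D.E hcentred) hindep hnoise0
    _ = ∫ ω, quad M (app D.A (X ω - Pr[X]) + app D.B (U ω - Pr[U])) ∂Pr + D.noiseCost ϱW M := by
        rw [LQData.noiseCost, ← h.law_W.integral_comp hnoise.aestronglyMeasurable]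
        rfl

/-- Taking expectations in the completed square, the value function `P` cancels by stationarity
except for the noise. -/
lemma stageCost_eq (h : IsStationaryStep D Pr ϱW X U W) (hP : D.IsRiccati P)
    (hR : (D.R₁ + D.R₂).PosDef) :
    D.stageCost Pr X U
      = D.detCost Pr[X] Pr[U] + D.noiseCost ϱW P + D.deviationCost Pr P X U := by
  have hξ : MemLp (fun ω => X ω - Pr[X]) 2 Pr := h.memLp_X.sub (memLp_const _)
  have hη : MemLp (fun ω => U ω - Pr[U]) 2 Pr := h.memLp_U.sub (memLp_const _)
  have hdrift : MemLp (fun ω => app D.A (X ω - Pr[X]) + app D.B (U ω - Pr[U])) 2 Pr :=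
    (memLp_app D.A hξ).add (memLp_app D.B hη)
  have hdev : MemLp (fun ω => U ω - Pr[U] - app (D.gain P) (X ω - Pr[X])) 2 Pr :=
    hη.sub (memLp_app _ hξ)
  have hsquare : ∫ ω, quad (D.Q₁ + D.Q₂) (X ω - Pr[X]) ∂Pr
        + ∫ ω, quad (D.R₁ + D.R₂) (U ω - Pr[U]) ∂Pr
        + ∫ ω, quad P (app D.A (X ω - Pr[X]) + app D.B (U ω - Pr[U])) ∂Pr
      = ∫ ω, quad P (X ω - Pr[X]) ∂Pr + D.deviationCost Pr P X U := by
    have hQξ := integrable_quad (D.Q₁ + D.Q₂) hξ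
    have hRη := integrable_quad (D.R₁ + D.R₂) hη
    rw [LQData.deviationCost, ← integral_add hQξ hRη,
      ← integral_add (hQξ.fun_add hRη) (integrable_quad P hdrift),
      ← integral_add (integrable_quad P hξ) (integrable_quad _ hdev)]
    exact integral_congr_ae (ae_of_all _ fun ω =>
      SolvesRiccati.complete_square hP.2 hP.1 hR _ _)
  rw [D.stageCost_eq_detCost_add h.memLp_X h.memLp_U]
  linarith [h.integral_quad_sub_integral P]

lemma integral_eq_of_ae_eq_affineFeedback (h : IsStationaryStep D Pr ϱW X U W)
    {K : Matrix (Fin l) (Fin n) ℝ} (hK : IsSchur (D.A + D.B * K))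
    (hs : D.IsSteadyState (mean ϱW) x u) (hU : U =ᵐ[Pr] affineFeedback K x u ∘ X) :
    Pr[X] = x ∧ Pr[U] = u := by
  have hXi := h.memLp_X.integrable one_le_two
  have hEU : Pr[U] = app K (Pr[X] - x) + u := by
    have hξ : Integrable (fun ω => X ω - x) Pr := hXi.sub (integrable_const x)
    rw [integral_congr_ae hU]
    simp only [Function.comp_apply, affineFeedback]
    rw [integral_add (integrable_app K hξ) (integrable_const u), integral_app K hξ,
      integral_sub hXi (integrable_const x)]
    simp
  have hEX : Pr[X] - x = 0 := by
    refine hK.eq_zero_of_app_eq_self ?_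
    have hf := D.f_sub_f Pr[X] x Pr[U] u (mean ϱW) (mean ϱW)
    rw [h.f_integral, LQData.isSteadyState_iff_f_eq.1 hs, hEU] at hf
    rw [add_app, mul_app]
    simpa using hf.symm
  exact ⟨sub_eq_zero.1 hEX, by rw [hEU, hEX, app_zero, zero_add]⟩

theorem ae_eq_affineFeedback_of_stageCost_le (h : IsStationaryStep D Pr ϱW X U W)
    (h' : IsStationaryStep D Pr ϱW X' U' W')
    (hU' : U' =ᵐ[Pr] affineFeedback (D.gain P) x u ∘ X')
    (hle : D.stageCost Pr X U ≤ D.stageCost Pr X' U')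
    (hopt : D.IsOptimalSteadyState (mean ϱW) x u) (hK : IsSchur (D.A + D.B * D.gain P))
    (hP : D.IsRiccati P) (hQ₁ : D.Q₁.PosSemidef) (hR₁ : D.R₁.PosDef) (hR₂ : D.R₂.PosSemidef)
    (hdetect : Detectable D.A (CFC.sqrt D.Q₁)) :
    U =ᵐ[Pr] affineFeedback (D.gain P) x u ∘ X := by
  have hR := hR₁.add_posSemidef hR₂
  have hsteady : D.IsSteadyState (mean ϱW) Pr[X] Pr[U] :=
    LQData.isSteadyState_iff_f_eq.2 h.f_integral
  obtain ⟨hEX', hEU'⟩ := h'.integral_eq_of_ae_eq_affineFeedback hK hopt.isSteadyState hU'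
  have hdev' : D.deviationCost Pr P X' U' = 0 := by
    rwa [LQData.deviationCost_eq_zero_iff hP.1 hR h'.memLp_X h'.memLp_U, hEX', hEU']
  rw [h.stageCost_eq hP hR, h'.stageCost_eq hP hR, hEX', hEU', hdev'] at hle
  have hdev := D.deviationCost_nonneg (Pr := Pr) hP.1 hR X U
  have hdet := hopt.detCost_le _ _ hsteady
  obtain ⟨hEX, hEU⟩ := hopt.eq_of_detCost_le hQ₁ hR₁ hdetect hsteady (by linarith)
  have hdev0 : D.deviationCost Pr P X U = 0 := by linarith
  rwa [LQData.deviationCost_eq_zero_iff hP.1 hR h.memLp_X h.memLp_U, hEX, hEU] at hdev0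

end IsStationaryStep

end StationaryStep

section Optimality

variable {Ω : Type*} [MeasurableSpace Ω] {Pr : Measure Ω} {n l m : ℕ} {D : LQData n l m}
  {ϱW : ProbabilityMeasure (Vec m)} {ϱ : ProbabilityMeasure (Vec n)} {π : Vec n → Vec l}
  {W : ℕ → Ω → Vec m} {P : Matrix (Fin n) (Fin n) ℝ} {xs xt x : Vec n} {us ut u : Vec l}

lemma isFeedbackLaw_affineFeedback [IsFiniteMeasure Pr] (K : Matrix (Fin l) (Fin n) ℝ) (x : Vec n)
    (u : Vec l) : IsFeedbackLaw Pr (affineFeedback K x u) :=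
  ⟨(continuous_affineFeedback K x u).measurable, fun _ hX =>
    (memLp_app K (hX.sub (memLp_const x))).add (memLp_const u)⟩

lemma IsFeasible.isStationaryStep {X : Ω → Vec n} {W : Ω → Vec m}
    (h : IsFeasible D Pr ϱW ϱ π X W) : IsStationaryStep D Pr ϱW X (π ∘ X) W where
  memLp_X := h.memLp_X
  memLp_U := h.feedback.2 X h.memLp_X
  memLp_W := h.memLp_W
  law_W := h.law_W
  indep := h.indep.comp (measurable_id.prodMk h.feedback.1) measurable_id
  identDistrib := h.law_next.identDistrib h.law_X

lemma IsAffineStationaryPair.ae_eq_affineFeedback {X : ℕ → Ω → Vec n} {U : ℕ → Ω → Vec l}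
    (h : IsAffineStationaryPair D Pr W P xs us xt ut X U) (k : ℕ) :
    U k =ᵐ[Pr] affineFeedback (D.gain P) (xs + xt) (us + ut) ∘ X k := by
  filter_upwards [h.2 k] with ω hω
  rw [hω, Function.comp_apply, affineFeedback, sub_sub, add_assoc, add_comm xt, add_comm ut]

lemma IsTrajectory.isFeasible_affineFeedback [IsFiniteMeasure Pr] {X : ℕ → Ω → Vec n}
    {U : ℕ → Ω → Vec l} {K : Matrix (Fin l) (Fin n) ℝ} (h : IsTrajectory D Pr W X U)
    (hU : U 0 =ᵐ[Pr] affineFeedback K x u ∘ X 0)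
    (hX₀ : HasLaw (X 0) (ϱ : Measure (Vec n)) Pr) (hX₁ : HasLaw (X 1) (ϱ : Measure (Vec n)) Pr)
    (hWp : MemLp (W 0) 2 Pr) (hW : HasLaw (W 0) (ϱW : Measure (Vec m)) Pr) :
    IsFeasible D Pr ϱW ϱ (affineFeedback K x u) (X 0) (W 0) where
  feedback := isFeedbackLaw_affineFeedback K x u
  memLp_X := h.memLp_X 0
  memLp_W := hWp
  law_X := hX₀
  law_W := hW
  indep := (h.indep 0).comp measurable_fst measurable_id
  law_next := hX₁.congr <| by
    filter_upwards [h.step 0, hU] with ω hstep hω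
    rw [hstep, hω, Function.comp_apply]

theorem IsStationaryOptimal.ae_eq_affineFeedback [IsProbabilityMeasure Pr]
    (hopt : IsStationaryOptimal D Pr ϱW ϱ π) {ϱ' : ProbabilityMeasure (Vec n)} {X' : Ω → Vec n}
    {W' : Ω → Vec m} (hfeas' : IsFeasible D Pr ϱW ϱ' (affineFeedback (D.gain P) x u) X' W')
    (hxu : D.IsOptimalSteadyState (mean ϱW) x u) (hK : IsSchur (D.A + D.B * D.gain P))
    (hP : D.IsRiccati P) (hQ₁ : D.Q₁.PosSemidef) (hR₁ : D.R₁.PosDef) (hR₂ : D.R₂.PosSemidef)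
    (hdetect : Detectable D.A (CFC.sqrt D.Q₁)) :
    π =ᵐ[(ϱ : Measure (Vec n))] affineFeedback (D.gain P) x u := by
  obtain ⟨X, W, hfeas, hmin⟩ := hopt
  have hU := hfeas.isStationaryStep.ae_eq_affineFeedback_of_stageCost_le hfeas'.isStationaryStep
    .rfl (hmin _ _ _ _ hfeas') hxu hK hP hQ₁ hR₁ hR₂ hdetect
  rw [← hfeas.law_X.map_eq]
  exact (ae_map_iff hfeas.law_X.aemeasurable (measurableSet_eq_fun hfeas.feedback.1
    (continuous_affineFeedback _ x u).measurable)).2 hU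

lemma IsStationaryFeedbackPair.ae_eq_comp {X : ℕ → Ω → Vec n} {U : ℕ → Ω → Vec l}
    (h : IsStationaryFeedbackPair D Pr W ϱ π X U) {π' : Vec n → Vec l}
    (hπ : π =ᵐ[(ϱ : Measure (Vec n))] π') (k : ℕ) : U k =ᵐ[Pr] π' ∘ X k := by
  obtain ⟨hX, hU⟩ := h.2.2.2 k
  rw [← hX.map_eq] at hπ
  exact hU.trans (ae_of_ae_map hX.aemeasurable hπ)

lemma IsTrajectory.sub_succ_ae_eq {X X' : ℕ → Ω → Vec n} {U U' : ℕ → Ω → Vec l}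
    {K : Matrix (Fin l) (Fin n) ℝ} {k : ℕ} (h : IsTrajectory D Pr W X U)
    (h' : IsTrajectory D Pr W X' U') (hU : U k =ᵐ[Pr] affineFeedback K x u ∘ X k)
    (hU' : U' k =ᵐ[Pr] affineFeedback K x u ∘ X' k) :
    ∀ᵐ ω ∂Pr, X (k + 1) ω - X' (k + 1) ω = app (D.A + D.B * K) (X k ω - X' k ω) := by
  filter_upwards [h.step k, h'.step k, hU, hU'] with ω hX hX' hω hω'
  rw [hX, hX', LQData.f_sub_f, hω, hω', Function.comp_apply, Function.comp_apply, affineFeedback,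
    affineFeedback, add_sub_add_right_eq_sub, ← app_sub, sub_sub_sub_cancel_right, sub_self,
    app_zero, add_zero, add_app, mul_app]

end Optimality

section GeometricDecay

variable {Ω F : Type*} [MeasurableSpace Ω] {Pr : Measure Ω} [NormedAddCommGroup F]
  {Z : ℕ → Ω → F} {C r : ℝ}

lemma tendsto_eLpNorm_zero_of_ae_norm_le_geometric {p : ENNReal} (hZ : MemLp (Z 0) p Pr)
    (hr : r ∈ Set.Ico 0 1) (hle : ∀ᵐ ω ∂Pr, ∀ k, ‖Z k ω‖ ≤ C * r ^ k * ‖Z 0 ω‖) :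
    Tendsto (fun k => eLpNorm (Z k) p Pr) atTop (𝓝 0) := by
  have hbound : ∀ k, eLpNorm (Z k) p Pr ≤ ENNReal.ofReal (C * r ^ k) * eLpNorm (Z 0) p Pr :=
    fun k => eLpNorm_le_mul_eLpNorm_of_ae_le_mul (hle.mono fun ω hω => hω k) p
  refine tendsto_of_tendsto_of_tendsto_of_le_of_le tendsto_const_nhds ?_
    (fun _ => zero_le) hbound
  have hgeom := (tendsto_pow_atTop_nhds_zero_of_lt_one hr.1 hr.2).const_mul C
  simpa using ENNReal.Tendsto.mul_const (ENNReal.tendsto_ofReal hgeom) (Or.inr hZ.eLpNorm_ne_top)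

lemma summable_integral_norm_pow_of_ae_norm_le_geometric {q : ℕ} (hq : q ≠ 0)
    (hZ : Integrable (fun ω => ‖Z 0 ω‖ ^ q) Pr) (hr : r ∈ Set.Ico 0 1)
    (hle : ∀ᵐ ω ∂Pr, ∀ k, ‖Z k ω‖ ≤ C * r ^ k * ‖Z 0 ω‖) :
    Summable fun k => ∫ ω, ‖Z k ω‖ ^ q ∂Pr := by
  have hbound : ∀ k, ∫ ω, ‖Z k ω‖ ^ q ∂Pr ≤ (C ^ q * ∫ ω, ‖Z 0 ω‖ ^ q ∂Pr) * (r ^ q) ^ k :=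
    fun k => by
      calc ∫ ω, ‖Z k ω‖ ^ q ∂Pr ≤ ∫ ω, (C * r ^ k) ^ q * ‖Z 0 ω‖ ^ q ∂Pr := by
            refine integral_mono_of_nonneg (ae_of_all _ fun _ => by positivity)
              (hZ.const_mul _) ?_
            filter_upwards [hle] with ω hω
            rw [← mul_pow]
            exact pow_le_pow_left₀ (norm_nonneg _) (hω k) q
        _ = (C ^ q * ∫ ω, ‖Z 0 ω‖ ^ q ∂Pr) * (r ^ q) ^ k := by
            rw [integral_const_mul]
            ring
  exact .of_nonneg_of_le (fun k => integral_nonneg fun _ => by positivity) hbound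
    ((summable_geometric_of_lt_one (pow_nonneg hr.1 q) (pow_lt_one₀ hr.1 hr.2 hq)).mul_left _)

end GeometricDecay

end StochLQ

end

open StochLQ in
theorem mainTheorem7_general {n l m : ℕ} {Ω : Type*} [MeasurableSpace Ω]
    (Pr : Measure Ω) [IsProbabilityMeasure Pr] (D : LQData n l m)
    (hQ₁ : D.Q₁.PosSemidef) (hQ₂ : D.Q₂.PosSemidef) (hR₁ : D.R₁.PosDef) (hR₂ : D.R₂.PosSemidef)
    (ϱW : ProbabilityMeasure (Vec m)) (W : ℕ → Ω → Vec m)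
    (hW : HasLaw (W 0) (ϱW : Measure (Vec m)) Pr)
    (xs : Vec n) (us : Vec l)
    (hsteady : D.IsSteadyState (mean ϱW) xs us)
    (hdetect : Detectable D.A (CFC.sqrt D.Q₁))
    (P : Matrix (Fin n) (Fin n) ℝ) (hP : D.IsRiccati P)
    (xt : Vec n) (ut : Vec l) (hshift : D.IsOptimalShift xs us xt ut)
    (Xstar : ℕ → Ω → Vec n) (Ustar : ℕ → Ω → Vec l)
    (hstar : IsAffineStationaryPair D Pr W P xs us xt ut Xstar Ustar)
    (ϱbar : ProbabilityMeasure (Vec n)) (πbar : Vec n → Vec l)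
    (hopt : IsStationaryOptimal D Pr ϱW ϱbar πbar)
    (Xbar : ℕ → Ω → Vec n) (Ubar : ℕ → Ω → Vec l)
    (hbar : IsStationaryFeedbackPair D Pr W ϱbar πbar Xbar Ubar) :
    ∃ C, ∃ r ∈ Set.Ico (0 : ℝ) 1, ∀ᵐ ω ∂Pr, ∀ k,
      ‖Xbar k ω - Xstar k ω‖ ≤ C * r ^ k * ‖Xbar 0 ω - Xstar 0 ω‖ := by
  have hK : IsSchur (D.A + D.B * D.gain P) :=
    hP.isSchur_add_mul_gain (hQ₁.add hQ₂) (hR₁.add_posSemidef hR₂)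
      (fun _ => app_sqrt_eq_zero_of_quad_add_eq_zero hQ₁ hQ₂) hdetect
  have hUstar := hstar.ae_eq_affineFeedback
  obtain ⟨htraj, ϱX, ϱU, -, -, hlaw⟩ := hstar.1
  have hWp : MemLp (W 0) 2 Pr := by
    obtain ⟨X, V, hfeas, -⟩ := hopt
    exact (hfeas.law_W.identDistrib hW).memLp_iff.1 hfeas.memLp_W
  have hπ := hopt.ae_eq_affineFeedback
    (htraj.isFeasible_affineFeedback (hUstar 0) (hlaw 0).1 (hlaw 1).1 hWp hW)
    (hshift.isOptimalSteadyState hsteady hQ₁.isHermitian hR₁.isHermitian)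
    hK hP hQ₁ hR₁ hR₂ hdetect
  have hstep := ae_all_iff.2 fun k =>
    hbar.1.sub_succ_ae_eq htraj (hbar.ae_eq_comp hπ k) (hUstar k)
  obtain ⟨C, r, hr, hdecay⟩ := hK.exists_norm_le_of_forall_succ_eq_app
  exact ⟨C, r, hr, hstep.mono fun ω hω => hdecay (fun k => Xbar k ω - Xstar k ω) hω⟩

theorem mainTheorem7 {n l m : ℕ} {Ω : Type*} [MeasurableSpace Ω]
    (Pr : Measure Ω) [IsProbabilityMeasure Pr]
    (D : StochLQ.LQData n l m) (hD : D.Standing)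
    (ϱW : ProbabilityMeasure (StochLQ.Vec m)) (W : ℕ → Ω → StochLQ.Vec m)
    (hW : StochLQ.IsNoise Pr ϱW W)
    (xs : StochLQ.Vec n) (us : StochLQ.Vec l)
    (hsteady : D.IsSteadyState (StochLQ.mean ϱW) xs us)
    (hdetect : StochLQ.Detectable D.A (CFC.sqrt D.Q₁))
    (P : Matrix (Fin n) (Fin n) ℝ) (hP : D.IsRiccati P)
    (xt : StochLQ.Vec n) (ut : StochLQ.Vec l) (hshift : D.IsOptimalShift xs us xt ut)
    (Xstar : ℕ → Ω → StochLQ.Vec n) (Ustar : ℕ → Ω → StochLQ.Vec l)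
    (hstar : StochLQ.IsAffineStationaryPair D Pr W P xs us xt ut Xstar Ustar)
    (ϱbar : ProbabilityMeasure (StochLQ.Vec n)) (πbar : StochLQ.Vec n → StochLQ.Vec l)
    (hopt : StochLQ.IsStationaryOptimal D Pr ϱW ϱbar πbar)
    (Xbar : ℕ → Ω → StochLQ.Vec n) (Ubar : ℕ → Ω → StochLQ.Vec l)
    (hbar : StochLQ.IsStationaryFeedbackPair D Pr W ϱbar πbar Xbar Ubar) :
    Tendsto (fun k => eLpNorm (Xbar k - Xstar k) 2 Pr) atTop (𝓝 0) ∧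
      ∃ C : ℝ, ∀ N : ℕ,
        (∑ k ∈ Finset.range N, ∫ ω, ‖Xbar k ω - Xstar k ω‖ ^ 2 ∂Pr) ≤ C := by
  obtain ⟨C, r, hr, hdecay⟩ := mainTheorem7_general Pr D hD.posSemidef_Q₁ hD.posSemidef_Q₂
    hD.posDef_R₁ hD.posSemidef_R₂ ϱW W (hW.hasLaw 0) xs us hsteady hdetect P hP xt ut hshift
    Xstar Ustar hstar ϱbar πbar hopt Xbar Ubar hbar
  have hZ : MemLp (Xbar 0 - Xstar 0) 2 Pr := (hbar.1.memLp_X 0).sub (hstar.1.1.memLp_X 0)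
  have hsum := StochLQ.summable_integral_norm_pow_of_ae_norm_le_geometric
    (Z := fun k => Xbar k - Xstar k) two_ne_zero hZ.norm.integrable_sq hr hdecay
  exact ⟨StochLQ.tendsto_eLpNorm_zero_of_ae_norm_le_geometric hZ hr hdecay, _, fun N =>
    hsum.sum_le_tsum _ fun k _ => integral_nonneg fun _ => sq_nonneg _⟩
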